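/- A weight function is a non-decreasing, continuous, unbounded function $w\colon[0,+\infty)\to(0,+\infty)$; it defines the radial weight $w(z)=w(|z|)$ on $\mathbb C^d$, where $|\cdot|$ is the Euclidean norm. The weight is called rapid if $\lim_{t\to\infty}t^{-k}w(t)=\infty$ for all $k\in\mathbb N$, and log-tropical if there are a set $E\subset\{0,1,2,\dots\}$ and real numbers $b_j$, $j\in E$, such that $\log w(e^x)=\sup_{j\in E}(b_j+jx)$ for all $x\in\mathbb R$, the supremum being finite for every $x$. For functions $u,v\colon X\to(0,+\infty)$, $u\asymp v$ means that $C_1u\le v\le C_2u$ on $X$ for some constants $C_1,C_2>0$. A proper holomorphic embedding $f\colon\mathbb C^d\to\mathbb C^n$ is an injective holomorphic map for which the preimage of every compact set is compact and whose complex Jacobian matrix has rank $d$ at every point. **Corollary 6.5.** For every $d\ge1$ there is a number $n=n(d)$, depending only on $d$, such that for every rapid log-tropical radial weight $w$ on $\mathbb C^d$ there exists a proper holomorphic embedding $f\colon\mathbb C^d\to\mathbb C^n$ with $|f(z)|\asymp w(z)$, $z\in\mathbb C^d$. -/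

import Mathlib

open Set Filter Topology

/-- `w : [0, ∞) → (0, ∞)` is a weight function: non-decreasing, continuous and unbounded.
Only the values of `w` on `[0, ∞)` matter. -/
structure IsWeightFunction (w : ℝ → ℝ) : Prop where
  pos : ∀ t, 0 ≤ t → 0 < w t
  monotoneOn : MonotoneOn w (Ici 0)
  continuousOn : ContinuousOn w (Ici 0)
  unbounded : ¬ BddAbove (w '' Ici 0)

/-- `w` is rapid: `t⁻ᵏ w(t) → ∞` as `t → ∞`, for every natural number `k`. -/
def IsRapid (w : ℝ → ℝ) : Prop :=
  ∀ k : ℕ, Tendsto (fun t : ℝ => (t ^ k)⁻¹ * w t) atTop atTop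

/-- `Ψ : ℝ → ℝ` is a tropical power series: `Ψ(x) = sup_{j ∈ E} (b_j + j x)` for some set `E` of
non-negative integers and some real numbers `b_j`, the supremum being finite for all real `x`
(this is part of `IsLUB` in `ℝ`, which also forces `E` to be non-empty). -/
def IsTropicalPowerSeries (Ψ : ℝ → ℝ) : Prop :=
  ∃ (E : Set ℕ) (b : ℕ → ℝ), ∀ x : ℝ, IsLUB ((fun j : ℕ => b j + (j : ℝ) * x) '' E) (Ψ x)

/-- The logarithmic transform `x ↦ log w(eˣ)` of a function on `[0, ∞)`. -/
noncomputable def logTransform (w : ℝ → ℝ) : ℝ → ℝ :=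
  fun x => Real.log (w (Real.exp x))

/-- `w` is log-tropical: its logarithmic transform is a tropical power series. -/
def IsLogTropical (w : ℝ → ℝ) : Prop :=
  IsTropicalPowerSeries (logTransform w)

/-- The radial extension `z ↦ w(|z|)` to `ℂᵈ`, with `|z|` the Euclidean norm. -/
noncomputable def radialWeight (d : ℕ) (w : ℝ → ℝ) : EuclideanSpace ℂ (Fin d) → ℝ :=
  fun z => w ‖z‖

/-- The relation `u ≍ v`: `C₁ u ≤ v ≤ C₂ u` on `X` for some constants `C₁, C₂ > 0`. -/
def FunEquivalent {X : Type*} (u v : X → ℝ) : Prop :=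
  ∃ C₁ C₂ : ℝ, 0 < C₁ ∧ 0 < C₂ ∧ ∀ x, C₁ * u x ≤ v x ∧ v x ≤ C₂ * u x

/-- A proper holomorphic embedding `ℂᵈ → ℂⁿ`: holomorphic, proper, with Jacobian of full rank `d`
at every point (an immersion), and one-to-one. -/
structure IsProperHolomorphicEmbedding {d n : ℕ}
    (f : EuclideanSpace ℂ (Fin d) → EuclideanSpace ℂ (Fin n)) : Prop where
  holomorphic : Differentiable ℂ f
  proper : IsProperMap f
  immersion : ∀ z, Function.Injective (fderiv ℂ f z)
  injective : Function.Injective f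

/-! Put `Ψ(x) = log w(eˣ)`, a supremum of lines with integer slopes. Start at 0 and move right,
switching at each exit point to the steepest touching line within `A` of `Ψ`. Rapidity forces every
line to be left behind, so this never stops. At each `x ≥ 0` some selected line is within `A` of
`Ψ`, and the others drop by `A` for every two steps of index (`exists_sparse_tropical`). Splitting
the selected indices modulo 4 gives four power series, one of which is dominated by a single term at
any given radius `R ≥ 1` (`exists_sparse_power_series`).

In several variables `|z|ʲ` is replaced by a family of homogeneous polynomials whose number does not
depend on `j` (`exists_homogeneous_family`). On the sphere a normalized monomial `z^α` is bounded by
a Gaussian in the variables `√α_i`. Exponents with square entries therefore sit on the integer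
lattice: their sums are bounded uniformly in `j`, and a residue class modulo a large `M` isolates
one dominant monomial.

Substituting these polynomials into the four series gives finitely many entire functions whose
maximum modulus is comparable to `w` off the unit ball (`exists_entire_family`). Adjoining the
constant 1 controls the unit ball. Adjoining the coordinates, which are `O(w)` by rapidity, provides
a linear left inverse and hence a proper embedding. -/

/-- The affine function `x ↦ b_j + j x`. -/
def tropicalLine (b : ℕ → ℝ) (j : ℕ) (x : ℝ) : ℝ := b j + (j : ℝ) * x

theorem tropicalLine_sub (b : ℕ → ℝ) (j : ℕ) (x y : ℝ) :
    tropicalLine b j x - tropicalLine b j y = j * (x - y) := by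
  unfold tropicalLine; ring

/-- If `ℓ_i + A ≤ ℓ_j` at `y` and `ℓ_j ≤ ℓ_i` at `t ≤ y`, then `ℓ_i + A ≤ ℓ_j` right of `y`. -/
theorem tropicalLine_gap_right {b : ℕ → ℝ} {i j : ℕ} {A t y x : ℝ} (hA : 0 < A)
    (hy : tropicalLine b i y + A ≤ tropicalLine b j y)
    (ht : tropicalLine b j t ≤ tropicalLine b i t) (hty : t ≤ y) (hyx : y ≤ x) :
    i < j ∧ tropicalLine b i x + A ≤ tropicalLine b j x := by
  unfold tropicalLine at *
  have hij : (i : ℝ) < j := by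
    by_contra! h
    nlinarith
  exact ⟨by exact_mod_cast hij, by nlinarith⟩

/-- If `ℓ_j + A ≤ ℓ_i` at `y` and `ℓ_i ≤ ℓ_j` at `t ≥ y`, then `ℓ_j + A ≤ ℓ_i` left of `y`. -/
theorem tropicalLine_gap_left {b : ℕ → ℝ} {i j : ℕ} {A t y x : ℝ} (hA : 0 < A)
    (hy : tropicalLine b j y + A ≤ tropicalLine b i y)
    (ht : tropicalLine b i t ≤ tropicalLine b j t) (hyt : y ≤ t) (hxy : x ≤ y) :
    tropicalLine b j x + A ≤ tropicalLine b i x := by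
  unfold tropicalLine at *
  have hij : (i : ℝ) < j := by
    by_contra! h
    nlinarith
  nlinarith

/-! ### Sparse subfamilies of tropical power series -/

section Selection

variable {Ψ : ℝ → ℝ} {E : Set ℕ} {b : ℕ → ℝ}

theorem tropicalLine_le (h : ∀ x, IsLUB ((fun j => tropicalLine b j x) '' E) (Ψ x)) {j : ℕ}
    (hj : j ∈ E) (x : ℝ) : tropicalLine b j x ≤ Ψ x :=
  (h x).1 ⟨j, hj, rfl⟩

/-- A line `A`-close to `Ψ` at `x` must not overtake `Ψ` at `x + 1`, which caps its integer slope.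
-/
theorem finite_tropicalLine_near (h : ∀ x, IsLUB ((fun j => tropicalLine b j x) '' E) (Ψ x))
    (A x : ℝ) : {j | j ∈ E ∧ Ψ x - A ≤ tropicalLine b j x}.Finite := by
  refine (Set.finite_Iic ⌈Ψ (x + 1) - Ψ x + A⌉₊).subset ?_
  rintro j ⟨hj, hjx⟩
  have h1 := tropicalLine_le h hj (x + 1)
  have h2 := tropicalLine_sub b j (x + 1) x
  have h3 : (j : ℝ) ≤ Ψ (x + 1) - Ψ x + A := by linarith
  have := h3.trans (Nat.le_ceil _)
  exact_mod_cast this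

theorem exists_tropicalLine_eq (h : ∀ x, IsLUB ((fun j => tropicalLine b j x) '' E) (Ψ x))
    (x : ℝ) : ∃ j ∈ E, tropicalLine b j x = Ψ x := by
  obtain ⟨_, ⟨j₀, hj₀, rfl⟩, h1, -⟩ := (h x).exists_between (show Ψ x - 1 < Ψ x by linarith)
  obtain ⟨j, ⟨hjE, hjx⟩, hmax⟩ := Set.exists_max_image _ (fun j => tropicalLine b j x)
    (finite_tropicalLine_near h 1 x) ⟨j₀, hj₀, h1.le⟩
  refine ⟨j, hjE, le_antisymm (tropicalLine_le h hjE x) ((h x).2 ?_)⟩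
  rintro _ ⟨i, hi, rfl⟩
  by_cases hix : Ψ x - 1 ≤ tropicalLine b i x
  · exact hmax i ⟨hi, hix⟩
  · dsimp only; linarith

/-- From a point `c`, the steepest touching line that is `A`-close to `Ψ` at `c`, and the last point
at which this line is `A`-close to `Ψ`. -/
theorem exists_steepest_line (h : ∀ x, IsLUB ((fun j => tropicalLine b j x) '' E) (Ψ x))
    (hcont : Continuous Ψ) (hfast : ∀ (j : ℕ) (B : ℝ), ∃ X, ∀ x ≥ X, B + j * x < Ψ x)
    {A : ℝ} (hA : 0 < A) (c : ℝ) :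
    ∃ (j : ℕ) (t c' : ℝ), j ∈ E ∧ tropicalLine b j t = Ψ t ∧
      Ψ c - A ≤ tropicalLine b j c ∧
      (∀ i ∈ E, (∃ s, tropicalLine b i s = Ψ s) → Ψ c - A ≤ tropicalLine b i c → i ≤ j) ∧
      c ≤ c' ∧ t ≤ c' ∧ tropicalLine b j c' + A = Ψ c' := by
  obtain ⟨j₀, hj₀, hj₀c⟩ := exists_tropicalLine_eq h c
  -- Only lines that touch `Ψ` somewhere compete: the touching points are what later orders slopes
  -- and propagates gaps.
  obtain ⟨j, ⟨⟨hjE, hjc⟩, t, ht⟩, hmax⟩ := Set.exists_max_image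
    {j | (j ∈ E ∧ Ψ c - A ≤ tropicalLine b j c) ∧ ∃ s, tropicalLine b j s = Ψ s} (fun j => j)
    ((finite_tropicalLine_near h A c).subset fun j hj => hj.1)
    ⟨j₀, ⟨hj₀, by linarith⟩, c, hj₀c⟩
  obtain ⟨X, hX⟩ := hfast j (b j + A)
  have hc : Continuous fun x => Ψ x - tropicalLine b j x := by
    unfold tropicalLine; fun_prop
  set p := max c t
  set q := max p X
  have hp : Ψ p - tropicalLine b j p ≤ A := by
    rcases max_choice c t with h' | h' <;> simp only [p, h'] <;> linarith
  have hq : A ≤ Ψ q - tropicalLine b j q := by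
    have := hX q (le_max_right _ _)
    unfold tropicalLine; linarith
  obtain ⟨c', ⟨hc1, -⟩, hc2⟩ := intermediate_value_Icc (le_max_left p X) hc.continuousOn ⟨hp, hq⟩
  exact ⟨j, t, c', hjE, ht, hjc, fun i hi hs hic => hmax i ⟨⟨hi, hic⟩, hs⟩,
    (le_max_left _ _).trans hc1, (le_max_right _ _).trans hc1, by dsimp only at hc2; linarith⟩

/-- A tropical power series of superlinear growth is equivalent to a sparse one: for every `x ≥ 0`
there is a term close to the supremum from which the other terms decay geometrically. -/
theorem exists_sparse_tropical (h : ∀ x, IsLUB ((fun j => tropicalLine b j x) '' E) (Ψ x))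
    (hcont : Continuous Ψ) (hmono : Monotone Ψ)
    (hfast : ∀ (j : ℕ) (B : ℝ), ∃ X, ∀ x ≥ X, B + j * x < Ψ x) {A : ℝ} (hA : 0 < A) :
    ∃ s : ℕ → ℕ, ∀ x : ℝ, 0 ≤ x → ∃ k, Ψ x - A ≤ tropicalLine b (s k) x ∧
      ∀ m i, (k + 2 * m ≤ i ∨ i + 2 * m ≤ k) →
        tropicalLine b (s i) x ≤ Ψ x - m * A := by
  choose J T N hJE hT hJc hmax hN hTN hNA using exists_steepest_line h hcont hfast hA
  set C : ℕ → ℝ := fun k => N^[k] 0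
  have hCs : ∀ k, C (k + 1) = N (C k) := fun k => Function.iterate_succ_apply' N k 0
  have hCm : Monotone C := monotone_nat_of_le_succ fun k => by rw [hCs]; exact hN _
  set s : ℕ → ℕ := fun k => J (C k)
  set t : ℕ → ℝ := fun k => T (C k)
  have hle : ∀ k x, tropicalLine b (s k) x ≤ Ψ x := fun k x => tropicalLine_le h (hJE _) x
  have ht : ∀ k, tropicalLine b (s k) (t k) = Ψ (t k) := fun k => hT _
  have htC : ∀ k, t k ≤ C (k + 1) := fun k => by rw [hCs]; exact hTN _
  have hCA : ∀ k, tropicalLine b (s k) (C (k + 1)) + A = Ψ (C (k + 1)) := fun k => by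
    rw [hCs]; exact hNA _
  have hnear : ∀ k, Ψ (C k) - A ≤ tropicalLine b (s k) (C k) := fun k => hJc _
  -- each selected line is far below `Ψ` after its exit point
  have hlow : ∀ k x, C (k + 1) ≤ x → tropicalLine b (s k) x + A ≤ Ψ x := by
    intro k x hx
    obtain ⟨i, hi, hix⟩ := exists_tropicalLine_eq h (C (k + 1))
    exact (tropicalLine_gap_right hA (by rw [hix, hCA])
      ((tropicalLine_le h hi (t k)).trans (ht k).ge) (htC k) hx).2.trans (tropicalLine_le h hi x)
  -- A line touching `Ψ` at `C (k + 1)` is steeper than `s k`, and it competes in the choice of `s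
  -- (k + 1)`.
  have hsmono : StrictMono s := by
    refine strictMono_nat_of_lt_succ fun k => ?_
    obtain ⟨i, hi, hix⟩ := exists_tropicalLine_eq h (C (k + 1))
    have h1 := (tropicalLine_gap_right hA (by rw [hix, hCA])
      ((tropicalLine_le h hi (t k)).trans (ht k).ge) (htC k) le_rfl).1
    exact h1.trans_le (hmax _ i hi ⟨_, hix⟩ (by rw [hix]; linarith))
  -- and before the entry point of its predecessor
  have hstrict : ∀ k i, k < i → tropicalLine b (s i) (C k) < Ψ (C k) - A := by
    intro k i hki
    by_contra! hc
    exact absurd (hmax _ (s i) (hJE _) ⟨_, ht i⟩ hc) (not_le.2 (hsmono hki))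
  have htge : ∀ k i, k < i → C k ≤ t i := by
    intro k i hki
    by_contra! hc
    have h1 := hstrict k i hki
    have h2 := hnear k
    have h3 := ht i
    have h4 := hle k (t i)
    have h5 := tropicalLine_sub b (s i) (C k) (t i)
    have h6 := tropicalLine_sub b (s k) (C k) (t i)
    have h7 : (s k : ℝ) < s i := by exact_mod_cast hsmono hki
    nlinarith
  have hhigh : ∀ k i x, k < i → x ≤ C k → tropicalLine b (s i) x + A ≤ Ψ x := by
    intro k i x hki hx
    obtain ⟨l, hl, hlx⟩ := exists_tropicalLine_eq h (C k)
    exact (tropicalLine_gap_left hA (by rw [hlx]; linarith [hstrict k i hki])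
      ((tropicalLine_le h hl (t i)).trans (ht i).ge) (htge k i hki) hx).trans
      (tropicalLine_le h hl x)
  -- The comparison skips an index because `t k` may lie beyond `C k`; it is only known that `t k ≤
  -- C (k + 1) ≤ t (k + 2)`.
  have hup : ∀ k x, x ≤ t k → tropicalLine b (s (k + 2)) x + A ≤ tropicalLine b (s k) x := by
    intro k x hx
    refine tropicalLine_gap_left hA ?_ ((hle k _).trans (ht (k + 2)).ge) ?_ hx
    · rw [ht]; exact hhigh (k + 1) (k + 2) _ (by omega) (htC k)
    · exact (htC k).trans (htge (k + 1) (k + 2) (by omega))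
  have hdown : ∀ k x, t (k + 2) ≤ x →
      tropicalLine b (s k) x + A ≤ tropicalLine b (s (k + 2)) x := by
    intro k x hx
    refine (tropicalLine_gap_right hA ?_ ((hle (k + 2) _).trans (ht k).ge) ?_ hx).2
    · rw [ht]; exact hlow k _ (htge (k + 1) (k + 2) (by omega))
    · exact (htC k).trans (htge (k + 1) (k + 2) (by omega))
  -- If all `C k` stayed below `x`, lines of slope at least `k` starting above `Ψ 0 - A` would
  -- exceed `Ψ (x + 1)`.
  have hunb : ∀ x, ∃ k, x < C k := by
    intro x
    by_contra! hc
    obtain ⟨k, hk⟩ := exists_nat_gt (Ψ (x + 1) - Ψ 0 + A)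
    have h1 := hle k (x + 1)
    have h2 := hnear k
    have h3 : Ψ 0 ≤ Ψ (C k) := hmono (hCm (Nat.zero_le k))
    have h4 := tropicalLine_sub b (s k) (x + 1) (C k)
    have h5 := hc k
    have h6 : (k : ℝ) ≤ s k := by exact_mod_cast hsmono.le_apply
    nlinarith
  refine ⟨s, fun x hx => ?_⟩
  classical
  obtain ⟨k, hk⟩ : ∃ k, Nat.find (hunb x) = k + 1 := by
    refine Nat.exists_eq_succ_of_ne_zero fun h0 => ?_
    have := Nat.find_spec (hunb x)
    rw [h0] at this
    exact absurd this (not_lt.2 hx)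
  have hk1 : x < C (k + 1) := hk ▸ Nat.find_spec (hunb x)
  have hk0 : C k ≤ x := not_lt.1 (Nat.find_min (hunb x) (by omega))
  refine ⟨k, ?_, ?_⟩
  -- The difference between the line optimal at `x` and line `s k` is affine and at most `A` at both
  -- `C k` and `C (k + 1)`, hence also at `x`.
  · obtain ⟨i, hi, hix⟩ := exists_tropicalLine_eq h x
    have h1 := hnear k
    have h2 := hCA k
    have h3 := tropicalLine_le h hi (C k)
    have h4 := tropicalLine_le h hi (C (k + 1))
    have h5 := tropicalLine_sub b i x (C k)
    have h6 := tropicalLine_sub b (s k) x (C k)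
    have h7 := tropicalLine_sub b i x (C (k + 1))
    have h8 := tropicalLine_sub b (s k) x (C (k + 1))
    rcases le_total (s k : ℝ) i with h9 | h9 <;> nlinarith
  · intro m
    induction m with
    | zero => intro i _; simpa using hle i x
    | succ m ih =>
      have hA' : Ψ x - (m + 1 : ℕ) * A = Ψ x - m * A - A := by push_cast; ring
      rw [hA']
      rintro i (hi | hi)
      · rcases Nat.eq_zero_or_pos m with rfl | hm
        · have := hhigh (k + 1) i x (by omega) hk1.le
          simp; linarith
        · obtain ⟨i, rfl⟩ := Nat.exists_eq_add_of_le' (show 2 ≤ i by omega)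
          have h1 := ih i (Or.inl (by omega))
          have h2 := hup i x (hk1.le.trans (htge (k + 1) i (by omega)))
          linarith
      · rcases Nat.eq_zero_or_pos m with rfl | hm
        · have := hlow i x ((hCm (by omega)).trans hk0)
          simp; linarith
        · have h1 := ih (i + 2) (Or.inr (by omega))
          have h2 := hdown i x ((htC (i + 2)).trans ((hCm (by omega)).trans hk0))
          linarith

end Selection

/-! ### Geometric and Gaussian sums -/

theorem summable_pow_natDist {θ : ℝ} (h0 : 0 ≤ θ) (h1 : θ < 1) (k : ℕ) :
    Summable fun q : ℕ => θ ^ (Nat.dist q k) := by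
  rw [← summable_nat_add_iff k]
  simpa [Nat.dist] using summable_geometric_of_lt_one h0 h1

theorem tsum_pow_natDist_le {θ : ℝ} (h0 : 0 ≤ θ) (h1 : θ ≤ 1 / 2) (k : ℕ) :
    ∑' q : ℕ, θ ^ (Nat.dist q k) ≤ 1 + 4 * θ := by
  have h2 : θ < 1 := by linarith
  have hinv : (1 - θ)⁻¹ ≤ 1 + 2 * θ := by
    rw [inv_le_iff_one_le_mul₀ (by linarith)]; nlinarith
  rw [← (summable_pow_natDist h0 h2 k).sum_add_tsum_nat_add k]
  have ha : ∑' q : ℕ, θ ^ (Nat.dist (q + k) k) = (1 - θ)⁻¹ := by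
    simpa [Nat.dist] using tsum_geometric_of_lt_one h0 h2
  have hb : ∑ q ∈ Finset.range k, θ ^ (Nat.dist q k) ≤ θ * (1 - θ)⁻¹ := by
    rw [← Finset.sum_range_reflect, ← tsum_geometric_of_lt_one h0 h2]
    calc ∑ q ∈ Finset.range k, θ ^ (Nat.dist (k - 1 - q) k)
        = θ * ∑ q ∈ Finset.range k, θ ^ q := by
          rw [Finset.mul_sum]
          refine Finset.sum_congr rfl fun q hq => ?_
          rw [Finset.mem_range] at hq
          rw [← pow_succ']
          congr 1
          unfold Nat.dist; omega
      _ ≤ _ := mul_le_mul_of_nonneg_left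
          ((summable_geometric_of_lt_one h0 h2).sum_le_tsum _ fun _ _ => by positivity) h0
  rw [ha]
  nlinarith

/-- Since `s² / 4 ≥ |s| - 1`, the Gaussian is dominated by a two-sided geometric sequence centred at
`⌊y⌋`. -/
theorem sum_gaussian_le (J : ℕ) {y : ℝ} (hy : 0 ≤ y) :
    ∑ n ∈ Finset.range J, Real.exp (-((n : ℝ) - y) ^ 2 / 4) ≤ 3 * Real.exp 2 := by
  have hθ : Real.exp (-1) ≤ 1 / 2 := by
    rw [Real.exp_neg, one_div]
    exact inv_anti₀ (by norm_num) (by linarith [Real.add_one_le_exp (1 : ℝ)])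
  set k := ⌊y⌋₊
  have hk1 : (k : ℝ) ≤ y := Nat.floor_le hy
  have hk2 : y < k + 1 := Nat.lt_floor_add_one y
  have hterm : ∀ n : ℕ, Real.exp (-((n : ℝ) - y) ^ 2 / 4)
      ≤ Real.exp 2 * Real.exp (-1) ^ (Nat.dist n k) := by
    intro n
    rw [← Real.exp_nat_mul, ← Real.exp_add]
    apply Real.exp_le_exp.2
    rcases le_total n k with h | h
    · have hd : ((Nat.dist n k : ℕ) : ℝ) = k - n := by
        rw [Nat.dist_eq_sub_of_le h, Nat.cast_sub h]
      rw [hd]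
      nlinarith [sq_nonneg (y - n - 2)]
    · have hd : ((Nat.dist n k : ℕ) : ℝ) = n - k := by
        rw [Nat.dist_eq_sub_of_le_right h, Nat.cast_sub h]
      rw [hd]
      nlinarith [sq_nonneg (n - y - 2)]
  calc _ ≤ ∑ n ∈ Finset.range J, Real.exp 2 * Real.exp (-1) ^ (Nat.dist n k) :=
        Finset.sum_le_sum fun n _ => hterm n
    _ = Real.exp 2 * ∑ n ∈ Finset.range J, Real.exp (-1) ^ (Nat.dist n k) := by
        rw [Finset.mul_sum]
    _ ≤ Real.exp 2 * 3 := by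
        gcongr
        refine ((summable_pow_natDist (Real.exp_pos _).le (by linarith) k).sum_le_tsum _
          fun _ _ => by positivity).trans ?_
        linarith [tsum_pow_natDist_le (Real.exp_pos _).le hθ k]
    _ = _ := by ring

theorem div_sqrt_pow_le {y : ℝ} (hy : 0 ≤ y) (a : ℕ) :
    (y / √a) ^ a ≤ Real.exp (√a * y - a) := by
  rcases Nat.eq_zero_or_pos a with rfl | ha
  · simp
  have ha' : (0 : ℝ) < a := by exact_mod_cast ha
  have h1 : y / √a ≤ Real.exp (y / √a - 1) := by
    linarith [Real.add_one_le_exp (y / √a - 1)]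
  calc (y / √a) ^ a ≤ Real.exp (y / √a - 1) ^ a := by gcongr
    _ = Real.exp (√a * y - a) := by
      rw [← Real.exp_nat_mul]
      congr 1
      have hs : √(a : ℝ) ≠ 0 := (Real.sqrt_pos.2 ha').ne'
      have h2 : (a : ℝ) / √a = √a := Real.div_sqrt
      rw [mul_sub, mul_one, mul_div_left_comm, h2, mul_comm]

theorem le_div_sqrt_pow {y : ℝ} (hy : 0 ≤ y) {a : ℕ} (h0 : y = 0 → a = 0) :
    Real.exp (-(a * (a / y ^ 2 - 1) / 2)) ≤ (y / √a) ^ a := by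
  rcases Nat.eq_zero_or_pos a with rfl | ha
  · simp
  have ha' : (0 : ℝ) < a := by exact_mod_cast ha
  have hy' : 0 < y := hy.lt_of_ne fun h => ha.ne' (h0 h.symm)
  have hs : 0 < √(a : ℝ) := Real.sqrt_pos.2 ha'
  have h1 : √a / y ≤ Real.exp ((a / y ^ 2 - 1) / 2) := by
    rw [← abs_of_pos (div_pos hs hy'), ← abs_of_pos (Real.exp_pos ((a / y ^ 2 - 1) / 2)),
      ← sq_le_sq, ← Real.exp_nat_mul, div_pow, Real.sq_sqrt ha'.le]
    push_cast
    rw [mul_div_cancel₀ _ two_ne_zero]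
    linarith [Real.add_one_le_exp ((a : ℝ) / y ^ 2 - 1)]
  have h2 : Real.exp (-((a / y ^ 2 - 1) / 2)) ≤ y / √a := by
    rw [Real.exp_neg, ← inv_div (√(a : ℝ))]
    exact inv_anti₀ (by positivity) h1
  calc Real.exp (-(a * (a / y ^ 2 - 1) / 2)) = Real.exp (-((a / y ^ 2 - 1) / 2)) ^ a := by
        rw [← Real.exp_nat_mul]; congr 1; ring
    _ ≤ _ := by gcongr

/-! ### Homogeneous polynomials comparable to a power of the norm -/

section Polynomials

variable {d : ℕ}

/-- The monomial `z^α` of degree `j`, normalized to have maximum modulus `1` on the unit sphere. -/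
noncomputable def normalizedMonomial (j : ℕ) (α : Fin d → ℕ) (z : EuclideanSpace ℂ (Fin d)) : ℂ :=
  ∏ i, (((√j : ℝ) : ℂ) * z i / ((√(α i) : ℝ) : ℂ)) ^ α i

/-- The exponent of degree `j` whose entries are `n_i²` for `i ≠ m` (when `n_m = 0`). -/
def squareExponent (j : ℕ) (m : Fin d) (n : Fin d → ℕ) (i : Fin d) : ℕ :=
  n i ^ 2 + if i = m then j - ∑ l, n l ^ 2 else 0

/-- Vectors `n` with `n_m = 0`, `∑ n_i² ≤ j` in a fixed residue class modulo `M`. -/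
def gridIndices (j M : ℕ) (m : Fin d) (ρ : Fin d → Fin M) : Finset (Fin d → ℕ) :=
  {n ∈ Fintype.piFinset fun _ => Finset.range (j + 1) |
    n m = 0 ∧ ∑ l, n l ^ 2 ≤ j ∧ ∀ i, n i % M = ρ i}

/-- A homogeneous polynomial of degree `j`: a sum of normalized monomials with sparse exponents. -/
noncomputable def gridPolynomial (j M : ℕ) (m : Fin d) (ρ : Fin d → Fin M)
    (z : EuclideanSpace ℂ (Fin d)) : ℂ :=
  ∑ n ∈ gridIndices j M m ρ, normalizedMonomial j (squareExponent j m n) z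

theorem mem_gridIndices {j M : ℕ} {m : Fin d} {ρ : Fin d → Fin M} {n : Fin d → ℕ} :
    n ∈ gridIndices j M m ρ ↔
      (∀ i, n i < j + 1) ∧ n m = 0 ∧ ∑ l, n l ^ 2 ≤ j ∧ ∀ i, n i % M = ρ i := by
  simp [gridIndices, Fintype.mem_piFinset]

theorem sum_squareExponent {j : ℕ} {m : Fin d} {n : Fin d → ℕ} (h : ∑ l, n l ^ 2 ≤ j) :
    ∑ i, squareExponent j m n i = j := by
  simp only [squareExponent, Finset.sum_add_distrib, Finset.sum_ite_eq', Finset.mem_univ, if_true]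
  omega

theorem differentiable_normalizedMonomial (j : ℕ) (α : Fin d → ℕ) :
    Differentiable ℂ (normalizedMonomial j α) := by
  unfold normalizedMonomial
  fun_prop

theorem differentiable_gridPolynomial (j M : ℕ) (m : Fin d) (ρ : Fin d → Fin M) :
    Differentiable ℂ (gridPolynomial j M m ρ) := by
  unfold gridPolynomial
  exact Differentiable.fun_sum fun n _ => differentiable_normalizedMonomial j _

theorem normalizedMonomial_smul {j : ℕ} {α : Fin d → ℕ} (hα : ∑ i, α i = j) (t : ℂ)
    (z : EuclideanSpace ℂ (Fin d)) :
    normalizedMonomial j α (t • z) = t ^ j * normalizedMonomial j α z := by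
  unfold normalizedMonomial
  have : t ^ j = ∏ i, t ^ α i := by rw [Finset.prod_pow_eq_pow_sum, hα]
  rw [this, ← Finset.prod_mul_distrib]
  refine Finset.prod_congr rfl fun i _ => ?_
  rw [← mul_pow]
  congr 1
  simp only [PiLp.smul_apply, smul_eq_mul]
  ring

theorem gridPolynomial_smul (j M : ℕ) (m : Fin d) (ρ : Fin d → Fin M) (t : ℂ)
    (z : EuclideanSpace ℂ (Fin d)) :
    gridPolynomial j M m ρ (t • z) = t ^ j * gridPolynomial j M m ρ z := by
  unfold gridPolynomial
  rw [Finset.mul_sum]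
  exact Finset.sum_congr rfl fun n hn =>
    normalizedMonomial_smul (sum_squareExponent (mem_gridIndices.1 hn).2.2.1) t z

theorem norm_normalizedMonomial (j : ℕ) (α : Fin d → ℕ) (z : EuclideanSpace ℂ (Fin d)) :
    ‖normalizedMonomial j α z‖ = ∏ i, (√j * ‖z i‖ / √(α i)) ^ α i := by
  simp [normalizedMonomial, norm_prod, abs_of_nonneg]

/-- Because `α_i` and `y_i²` have the same sum `j`, the exponents `√α_i y_i - α_i` from
`div_sqrt_pow_le` add up to a perfect square. -/
theorem prod_div_sqrt_pow_le {j : ℕ} {α : Fin d → ℕ} (hα : ∑ i, α i = j) {y : Fin d → ℝ}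
    (hy : ∀ i, 0 ≤ y i) (hyj : ∑ i, y i ^ 2 = j) :
    ∏ i, (y i / √(α i)) ^ α i ≤ Real.exp (-(∑ i, (√(α i) - y i) ^ 2) / 2) := by
  calc _ ≤ ∏ i, Real.exp (√(α i) * y i - α i) :=
        Finset.prod_le_prod (fun i _ => pow_nonneg (div_nonneg (hy i) (Real.sqrt_nonneg _)) _)
          fun i _ => div_sqrt_pow_le (hy i) _
    _ = _ := by
      rw [← Real.exp_sum]
      congr 1
      have h1 : ∑ i, (α i : ℝ) = j := by exact_mod_cast hα
      have h2 : ∀ i, (√(α i : ℝ) - y i) ^ 2 = α i - 2 * (√(α i) * y i) + y i ^ 2 := fun i => by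
        rw [sub_sq, Real.sq_sqrt (Nat.cast_nonneg _)]; ring
      simp only [h2, Finset.sum_sub_distrib, Finset.sum_add_distrib, ← Finset.mul_sum, h1, hyj]
      ring

/-- The equal sums now turn the exponents of `le_div_sqrt_pow` into a chi-square distance between
`α` and `y²`. -/
theorem le_prod_div_sqrt_pow {j : ℕ} {α : Fin d → ℕ} (hα : ∑ i, α i = j) {y : Fin d → ℝ}
    (hy : ∀ i, 0 ≤ y i) (hyj : ∑ i, y i ^ 2 = j) (h0 : ∀ i, y i = 0 → α i = 0) :
    Real.exp (-(∑ i, (α i - y i ^ 2) ^ 2 / y i ^ 2) / 2) ≤ ∏ i, (y i / √(α i)) ^ α i := by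
  calc _ = ∏ i, Real.exp (-(α i * (α i / y i ^ 2 - 1) / 2)) := by
        rw [← Real.exp_sum]
        congr 1
        have h1 : ∑ i, (α i : ℝ) = j := by exact_mod_cast hα
        have h2 : ∀ i, ((α i : ℝ) - y i ^ 2) ^ 2 / y i ^ 2
            = α i * (α i / y i ^ 2 - 1) - (α i - y i ^ 2) := fun i => by
          rcases (hy i).eq_or_lt with h | h
          · simp [← h, h0 i h.symm]
          · field_simp
        simp only [h2, Finset.sum_sub_distrib, h1, hyj, Finset.sum_neg_distrib, ← Finset.sum_div]
        ring
    _ ≤ _ := Finset.prod_le_prod (fun i _ => (Real.exp_pos _).le)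
        fun i _ => le_div_sqrt_pow (hy i) (h0 i)

theorem sum_gridIndices_gaussian_le (j M : ℕ) (m : Fin d) (ρ : Fin d → Fin M) {y : Fin d → ℝ}
    (hy : ∀ i, 0 ≤ y i) :
    ∑ n ∈ gridIndices j M m ρ,
      Real.exp (-(∑ i, (√(squareExponent j m n i) - y i) ^ 2) / 4) ≤ (3 * Real.exp 2) ^ d := by
  -- The coordinate `m` is slaved to the others; its Gaussian factor is bounded by 1, which is the
  -- value at `n m = 0`, `y' m = 0`.
  set y' := Function.update y m 0
  have hy' : ∀ i, 0 ≤ y' i := fun i => by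
    rcases eq_or_ne i m with rfl | h
    · simp [y']
    · simpa [y', h] using hy i
  calc _ ≤ ∑ n ∈ gridIndices j M m ρ, ∏ i, Real.exp (-((n i : ℝ) - y' i) ^ 2 / 4) := by
        refine Finset.sum_le_sum fun n hn => ?_
        rw [← Real.exp_sum, Real.exp_le_exp, ← Finset.sum_div, Finset.sum_neg_distrib]
        gcongr ?_ / 4
        refine neg_le_neg (Finset.sum_le_sum fun i _ => ?_)
        rcases eq_or_ne i m with rfl | h
        · simp [y', (mem_gridIndices.1 hn).2.1, sq_nonneg]
        · simp [y', h, squareExponent]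
    _ ≤ ∑ n ∈ Fintype.piFinset fun _ : Fin d => Finset.range (j + 1),
          ∏ i, Real.exp (-((n i : ℝ) - y' i) ^ 2 / 4) :=
        Finset.sum_le_sum_of_subset_of_nonneg (Finset.filter_subset _ _)
          fun _ _ _ => Finset.prod_nonneg fun _ _ => (Real.exp_pos _).le
    _ = ∏ i, ∑ n ∈ Finset.range (j + 1), Real.exp (-((n : ℝ) - y' i) ^ 2 / 4) :=
        Finset.sum_prod_piFinset (Finset.range (j + 1))
          fun i (n : ℕ) => Real.exp (-((n : ℝ) - y' i) ^ 2 / 4)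
    _ ≤ ∏ _i : Fin d, 3 * Real.exp 2 :=
        Finset.prod_le_prod (fun _ _ => Finset.sum_nonneg fun _ _ => (Real.exp_pos _).le)
          fun i _ => sum_gaussian_le _ (hy' i)
    _ = _ := by simp

theorem sum_sq_sqrt_mul_norm (j : ℕ) {z : EuclideanSpace ℂ (Fin d)} (hz : ‖z‖ = 1) :
    ∑ i, (√j * ‖z i‖) ^ 2 = j := by
  have := EuclideanSpace.norm_sq_eq z
  simp only [mul_pow, ← Finset.mul_sum, ← this, hz, Real.sq_sqrt (Nat.cast_nonneg j)]
  simp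

theorem norm_gridPolynomial_le_of_norm_eq_one (j M : ℕ) (m : Fin d) (ρ : Fin d → Fin M)
    {z : EuclideanSpace ℂ (Fin d)} (hz : ‖z‖ = 1) :
    ‖gridPolynomial j M m ρ z‖ ≤ (3 * Real.exp 2) ^ d := by
  have hy : ∀ i, 0 ≤ √j * ‖z i‖ := fun i => by positivity
  refine (norm_sum_le _ _).trans ((Finset.sum_le_sum fun n hn => ?_).trans
    (sum_gridIndices_gaussian_le j M m ρ hy))
  rw [norm_normalizedMonomial]
  refine (prod_div_sqrt_pow_le (sum_squareExponent (mem_gridIndices.1 hn).2.2.1) hy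
    (sum_sq_sqrt_mul_norm j hz)).trans ?_
  apply Real.exp_le_exp.2
  have : 0 ≤ ∑ i, (√(squareExponent j m n i) - √j * ‖z i‖) ^ 2 :=
    Finset.sum_nonneg fun _ _ => sq_nonneg _
  linarith

/-- Rounding `√j |z_i|` down selects a monomial of size bounded below. Any other exponent in its
residue class is at least `M - 1` away in some coordinate, so half of the Gaussian exponent gives
the small factor and the other half keeps the sum bounded. -/
theorem exists_le_norm_gridPolynomial (j : ℕ) {M : ℕ} (hM : 0 < M)
    (hM' : Real.exp (-((M : ℝ) - 1) ^ 2 / 4) * (3 * Real.exp 2) ^ d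
      ≤ Real.exp (-(4 * d + 4 * d ^ 2) / 2) / 2)
    {z : EuclideanSpace ℂ (Fin d)} (hz : ‖z‖ = 1) :
    ∃ m ρ, Real.exp (-(4 * d + 4 * d ^ 2) / 2) / 2 ≤ ‖gridPolynomial j M m ρ z‖ := by
  classical
  set y : Fin d → ℝ := fun i => √j * ‖z i‖ with hydef
  have hy : ∀ i, 0 ≤ y i := fun i => by positivity
  have hyj : ∑ i, y i ^ 2 = j := sum_sq_sqrt_mul_norm j hz
  have : Nonempty (Fin d) := by
    by_contra h
    rw [not_nonempty_iff] at h
    rw [Subsingleton.elim z 0] at hz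
    simp at hz
  -- The largest coordinate absorbs the rounding errors of all the others, so its relative error
  -- stays bounded.
  obtain ⟨m, hm⟩ := Finite.exists_max y
  set n : Fin d → ℕ := fun i => if i = m then 0 else ⌊y i⌋₊ with hn
  have hny : ∀ i, (n i : ℝ) ≤ y i := fun i => by
    by_cases h : i = m
    · simp [hn, h, hy]
    · simpa [hn, h] using Nat.floor_le (hy i)
  have hny' : ∀ i, i ≠ m → y i < n i + 1 := fun i h => by
    simpa [hn, h] using Nat.lt_floor_add_one (y i)
  have hsum : ∑ l, n l ^ 2 ≤ j := by
    have : (∑ l, (n l : ℝ) ^ 2) ≤ j := by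
      rw [← hyj]
      gcongr with l
      exact hny l
    exact_mod_cast this
  set ρ : Fin d → Fin M := fun i => ⟨n i % M, Nat.mod_lt _ hM⟩
  have hnS : n ∈ gridIndices j M m ρ := by
    refine mem_gridIndices.2 ⟨fun i => ?_, by simp [hn], hsum, fun i => rfl⟩
    have h1 : n i ^ 2 ≤ ∑ l, n l ^ 2 :=
      Finset.single_le_sum (f := fun l => n l ^ 2) (fun _ _ => Nat.zero_le _) (Finset.mem_univ i)
    have h2 : n i ≤ n i ^ 2 := Nat.le_self_pow two_ne_zero _
    omega
  set α := squareExponent j m n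
  have hα : ∑ i, α i = j := sum_squareExponent hsum
  have hαi : ∀ i, i ≠ m → α i = n i ^ 2 := fun i h => by simp [α, squareExponent, h]
  have hbd : ∀ i, i ≠ m → |(α i : ℝ) - y i ^ 2| ≤ 2 * y i := fun i h => by
    rw [hαi i h, abs_le]
    have h1 := hny i
    have h2 := hny' i h
    have h3 : (0 : ℝ) ≤ n i := Nat.cast_nonneg _
    push_cast
    constructor <;> nlinarith
  -- The deviations sum to zero, so the one at `m` is minus the sum of the others, each at most `2
  -- y_i ≤ 2 y_m`.
  have hbdm : |(α m : ℝ) - y m ^ 2| ≤ 2 * d * y m := by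
    have h1 : ∑ i, ((α i : ℝ) - y i ^ 2) = 0 := by
      rw [Finset.sum_sub_distrib, hyj, sub_eq_zero]; exact_mod_cast hα
    rw [← Finset.add_sum_erase _ _ (Finset.mem_univ m)] at h1
    rw [eq_neg_of_add_eq_zero_left h1, abs_neg]
    refine (Finset.abs_sum_le_sum_abs _ _).trans ?_
    calc _ ≤ ∑ _i ∈ Finset.univ.erase m, 2 * y m :=
          Finset.sum_le_sum fun i hi => (hbd i (Finset.ne_of_mem_erase hi)).trans
            (by linarith [hm i])
      _ ≤ ∑ _i : Fin d, 2 * y m :=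
          Finset.sum_le_sum_of_subset_of_nonneg (Finset.erase_subset _ _)
            fun _ _ _ => by linarith [hy m]
      _ = _ := by simp; ring
  have hmain : Real.exp (-(4 * d + 4 * d ^ 2) / 2) ≤ ‖normalizedMonomial j α z‖ := by
    rw [norm_normalizedMonomial]
    refine le_trans ?_ (le_prod_div_sqrt_pow hα hy hyj fun i hi => ?_)
    · apply Real.exp_le_exp.2
      have hone : ∀ i (D : ℝ), 0 ≤ D → |(α i : ℝ) - y i ^ 2| ≤ D * y i →
          ((α i : ℝ) - y i ^ 2) ^ 2 / y i ^ 2 ≤ D ^ 2 := fun i D hD h => by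
        refine div_le_of_le_mul₀ (sq_nonneg _) (sq_nonneg _) ?_
        rw [← mul_pow, sq_le_sq, abs_of_nonneg (mul_nonneg hD (hy i))]
        exact h
      have : ∑ i, ((α i : ℝ) - y i ^ 2) ^ 2 / y i ^ 2 ≤ 4 * d + 4 * d ^ 2 := by
        rw [← Finset.sum_erase_add _ _ (Finset.mem_univ m)]
        refine add_le_add ?_ ((hone m (2 * d) (by positivity) hbdm).trans (by ring_nf; rfl))
        calc _ ≤ ∑ _i ∈ Finset.univ.erase m, (4 : ℝ) :=
              Finset.sum_le_sum fun i hi =>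
                (hone i 2 (by norm_num) (hbd i (Finset.ne_of_mem_erase hi))).trans (by norm_num)
          _ ≤ ∑ _i : Fin d, (4 : ℝ) :=
              Finset.sum_le_sum_of_subset_of_nonneg (Finset.erase_subset _ _)
                fun _ _ _ => by norm_num
          _ = _ := by simp; ring
      linarith
    · by_cases h : i = m
      · have hz0 : ∀ l, y l = 0 := fun l => le_antisymm ((hm l).trans (h ▸ hi).le) (hy l)
        have : j = 0 := by simpa [hz0] using hyj.symm
        rw [this] at hα
        exact (Finset.sum_eq_zero_iff.1 hα) i (Finset.mem_univ i)
      · rw [hαi i h]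
        have : (n i : ℝ) ≤ 0 := hi ▸ hny i
        have : n i = 0 := by exact_mod_cast le_antisymm this (Nat.cast_nonneg _)
        simp [this]
  have hrest : ‖∑ n' ∈ (gridIndices j M m ρ).erase n,
      normalizedMonomial j (squareExponent j m n') z‖
      ≤ Real.exp (-(4 * d + 4 * d ^ 2) / 2) / 2 := by
    refine le_trans ?_ hM'
    refine (norm_sum_le _ _).trans ?_
    calc _ ≤ ∑ n' ∈ (gridIndices j M m ρ).erase n, Real.exp (-((M : ℝ) - 1) ^ 2 / 4) *
            Real.exp (-(∑ i, (√(squareExponent j m n' i) - y i) ^ 2) / 4) := by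
          refine Finset.sum_le_sum fun n' hn' => ?_
          obtain ⟨hne, hn'S⟩ := Finset.mem_erase.1 hn'
          have hS := mem_gridIndices.1 hn'S
          rw [norm_normalizedMonomial]
          refine (prod_div_sqrt_pow_le (sum_squareExponent hS.2.2.1) hy hyj).trans ?_
          rw [← Real.exp_add]
          apply Real.exp_le_exp.2
          obtain ⟨i, hi⟩ := Function.ne_iff.1 hne
          have him : i ≠ m := by
            rintro rfl
            exact hi (by simp [hS.2.1, hn])
          have hfar : ((M : ℝ) - 1) ^ 2 ≤ (√(squareExponent j m n' i) - y i) ^ 2 := by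
            have hsq : √(squareExponent j m n' i : ℝ) = n' i := by
              simp [squareExponent, him]
            have hmod : n' i % M = n i % M := hS.2.2.2 i
            have h1 := hny i
            have h2 := hny' i him
            have hM1 : (1 : ℝ) ≤ M := by exact_mod_cast hM
            rw [hsq]
            rcases lt_or_gt_of_ne hi with h | h
            · obtain ⟨q, hq⟩ := (Nat.modEq_iff_dvd' h.le).1 hmod
              have hq0 : q ≠ 0 := by rintro rfl; omega
              have : M ≤ n i - n' i := hq ▸ Nat.le_mul_of_pos_right M (Nat.pos_of_ne_zero hq0)
              have : n' i + M ≤ n i := by omega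
              have : (n' i : ℝ) + M ≤ n i := by exact_mod_cast this
              nlinarith
            · obtain ⟨q, hq⟩ := (Nat.modEq_iff_dvd' h.le).1 (show n i ≡ n' i [MOD M] from hmod.symm)
              have hq0 : q ≠ 0 := by rintro rfl; omega
              have : M ≤ n' i - n i := hq ▸ Nat.le_mul_of_pos_right M (Nat.pos_of_ne_zero hq0)
              have : n i + M ≤ n' i := by omega
              have : (n i : ℝ) + M ≤ n' i := by exact_mod_cast this
              nlinarith
          have := Finset.single_le_sum
            (f := fun i => (√(squareExponent j m n' i : ℝ) - y i) ^ 2)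
            (fun _ _ => sq_nonneg _) (Finset.mem_univ i)
          linarith
      _ ≤ Real.exp (-((M : ℝ) - 1) ^ 2 / 4) * ∑ n' ∈ gridIndices j M m ρ,
            Real.exp (-(∑ i, (√(squareExponent j m n' i) - y i) ^ 2) / 4) := by
          rw [← Finset.mul_sum]
          gcongr
          exact Finset.erase_subset _ _
      _ ≤ _ := by
          gcongr
          exact sum_gridIndices_gaussian_le j M m ρ hy
  refine ⟨m, ρ, ?_⟩
  unfold gridPolynomial
  rw [← Finset.add_sum_erase _ _ hnS]
  have := norm_sub_le_norm_add (normalizedMonomial j α z)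
    (∑ n' ∈ (gridIndices j M m ρ).erase n, normalizedMonomial j (squareExponent j m n') z)
  linarith

theorem exists_norm_eq_one_smul (hd : 1 ≤ d) (z : EuclideanSpace ℂ (Fin d)) :
    ∃ ζ : EuclideanSpace ℂ (Fin d), ‖ζ‖ = 1 ∧ z = (‖z‖ : ℂ) • ζ := by
  rcases eq_or_ne z 0 with rfl | hz
  · exact ⟨EuclideanSpace.single ⟨0, hd⟩ 1, by simp, by simp⟩
  · have h : (‖z‖ : ℂ) ≠ 0 := by simpa using hz
    exact ⟨(‖z‖ : ℂ)⁻¹ • z, by simp [norm_smul, hz], by rw [smul_smul, mul_inv_cancel₀ h, one_smul]⟩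

/-- For each `d` there are finite families, of a size that does not depend on the degree `j`, of
homogeneous polynomials `W` of degree `j` on `ℂᵈ` with `max |W| ≍ |z|ʲ` uniformly in `j`. -/
theorem exists_homogeneous_family (hd : 1 ≤ d) :
    ∃ (M : ℕ) (K δ : ℝ), 0 < K ∧ 0 < δ ∧
      ∃ W : ℕ → Fin d × (Fin d → Fin M) → EuclideanSpace ℂ (Fin d) → ℂ,
        (∀ j a, Differentiable ℂ (W j a)) ∧ (∀ j a z, ‖W j a z‖ ≤ K * ‖z‖ ^ j) ∧
        ∀ j z, ∃ a, δ * ‖z‖ ^ j ≤ ‖W j a z‖ := by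
  set K : ℝ := (3 * Real.exp 2) ^ d
  set c : ℝ := Real.exp (-(4 * d + 4 * d ^ 2) / 2) / 2
  have hK : 0 < K := by positivity
  have hc : 0 < c := by positivity
  obtain ⟨L, hL⟩ := exists_nat_gt (4 * (K / c))
  have hM : Real.exp (-(((L + 2 : ℕ) : ℝ) - 1) ^ 2 / 4) * K ≤ c := by
    rw [neg_div, Real.exp_neg, inv_mul_le_iff₀ (Real.exp_pos _)]
    have h1 := Real.add_one_le_exp ((((L + 2 : ℕ) : ℝ) - 1) ^ 2 / 4)
    have h2 : K / c ≤ (((L + 2 : ℕ) : ℝ) - 1) ^ 2 / 4 := by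
      have : (0 : ℝ) ≤ L := Nat.cast_nonneg _
      push_cast
      nlinarith
    have h3 : K / c ≤ Real.exp ((((L + 2 : ℕ) : ℝ) - 1) ^ 2 / 4) := by linarith
    rwa [div_le_iff₀ hc] at h3
  refine ⟨L + 2, K, c, hK, hc, fun j a => gridPolynomial j (L + 2) a.1 a.2,
    fun j a => differentiable_gridPolynomial _ _ _ _, fun j a z => ?_, fun j z => ?_⟩
  · obtain ⟨ζ, hζ, hz⟩ := exists_norm_eq_one_smul hd z
    have := norm_gridPolynomial_le_of_norm_eq_one j (L + 2) a.1 a.2 hζ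
    have h2 : ‖gridPolynomial j (L + 2) a.1 a.2 z‖
        = ‖z‖ ^ j * ‖gridPolynomial j (L + 2) a.1 a.2 ζ‖ := by
      conv_lhs => rw [hz, gridPolynomial_smul]
      simp
    rw [h2, mul_comm]
    gcongr
  · obtain ⟨ζ, hζ, hz⟩ := exists_norm_eq_one_smul hd z
    obtain ⟨m, ρ, h⟩ := exists_le_norm_gridPolynomial j (M := L + 2) (by omega) hM hζ
    refine ⟨(m, ρ), ?_⟩
    have h2 : ‖gridPolynomial j (L + 2) m ρ z‖ = ‖z‖ ^ j * ‖gridPolynomial j (L + 2) m ρ ζ‖ := by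
      conv_lhs => rw [hz, gridPolynomial_smul]
      simp
    rw [h2, mul_comm]
    gcongr

end Polynomials

/-! ### Entire functions from sparse series -/

/-- A locally normally convergent series of entire functions is entire. -/
theorem differentiable_tsum_of_norm_le {E : Type*} [NormedAddCommGroup E] [NormedSpace ℂ E]
    {f : ℕ → E → ℂ} (hf : ∀ n, Differentiable ℂ (f n))
    (hu : ∀ R : ℝ, ∃ u : ℕ → ℝ, Summable u ∧ ∀ n z, ‖z‖ ≤ R → ‖f n z‖ ≤ u n) :
    Differentiable ℂ fun z => ∑' n, f n z := by
  let _ : NormedSpace ℝ E := NormedSpace.restrictScalars ℝ ℂ E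
  intro z
  obtain ⟨u, hus, hu⟩ := hu (‖z‖ + 2)
  have hz : z ∈ Metric.ball (0 : E) (‖z‖ + 1) := by simp
  refine (hasFDerivAt_tsum_of_isPreconnected (hus.mul_left 2) Metric.isOpen_ball
    (convex_ball (0 : E) (‖z‖ + 1)).isPreconnected (f' := fun n y => fderiv ℂ (f n) y)
    (fun n y _ => (hf n y).hasFDerivAt) (fun n y hy => ?_) hz
    (Summable.of_norm_bounded hus fun n => hu n z (by linarith)) hz).differentiableAt
  rw [mem_ball_zero_iff] at hy
  -- Cauchy-type estimate on the unit ball about `y`, which stays inside radius `‖z‖ + 2`.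
  have := Complex.norm_fderiv_le_div_of_mapsTo_ball (f := f n) (c := y) (R₁ := 1) (R₂ := 2 * u n)
    (hf n).differentiableOn (fun x hx => ?_) one_pos
  · simpa using this
  · rw [mem_ball_iff_norm] at hx
    rw [mem_closedBall_iff_norm]
    have h1 : ‖x‖ ≤ ‖z‖ + 2 := by linarith [norm_sub_norm_le x y]
    linarith [norm_sub_le (f n x) (f n y), hu n x h1, hu n y (by linarith)]

section Weight

variable {w : ℝ → ℝ}

theorem IsWeightFunction.continuous_logTransform (hw : IsWeightFunction w) :
    Continuous (logTransform w) := by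
  unfold logTransform
  refine Continuous.log ?_ fun x => (hw.pos _ (Real.exp_pos x).le).ne'
  exact hw.continuousOn.comp_continuous Real.continuous_exp fun x => (Real.exp_pos x).le

theorem IsWeightFunction.monotone_logTransform (hw : IsWeightFunction w) :
    Monotone (logTransform w) := fun x y hxy =>
  Real.log_le_log (hw.pos _ (Real.exp_pos x).le)
    (hw.monotoneOn (Real.exp_pos x).le (Real.exp_pos y).le (Real.exp_le_exp.2 hxy))

theorem IsRapid.exists_lt_logTransform (hr : IsRapid w) (j : ℕ) (B : ℝ) :
    ∃ X, ∀ x ≥ X, B + j * x < logTransform w x := by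
  obtain ⟨X, hX⟩ := eventually_atTop.1
    (Real.tendsto_exp_atTop.eventually ((hr j).eventually_gt_atTop (Real.exp B)))
  refine ⟨X, fun x hx => ?_⟩
  have h := hX x hx
  have hp : 0 < Real.exp x ^ j := by positivity
  rw [inv_mul_eq_div, lt_div_iff₀ hp, ← Real.exp_nat_mul, ← Real.exp_add] at h
  rw [logTransform, Real.lt_log_iff_exp_lt ((Real.exp_pos _).trans h)]
  exact h

theorem exp_tropicalLine_log (b : ℕ → ℝ) (j : ℕ) {R : ℝ} (hR : 0 < R) :
    Real.exp (tropicalLine b j (Real.log R)) = Real.exp (b j) * R ^ j := by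
  rw [tropicalLine, Real.exp_add, Real.exp_nat_mul, Real.exp_log hR]

/-- A rapid log-tropical weight is equivalent, on `[1, ∞)`, to the sum of four power series with
non-negative coefficients; at every point one of the four is dominated by a single term. -/
theorem exists_sparse_power_series (hw : IsWeightFunction w) (hr : IsRapid w)
    (ht : IsLogTropical w) {θ : ℝ} (hθ0 : 0 < θ) (hθ1 : θ < 1) :
    ∃ (v : Fin 4 → ℕ → ℕ) (β : Fin 4 → ℕ → ℝ), (∀ r q, 0 < β r q) ∧
      ∀ R : ℝ, 1 ≤ R → ∃ q₀ r₀, θ * w R ≤ β r₀ q₀ * R ^ v r₀ q₀ ∧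
        (∀ r q, β r q * R ^ v r q ≤ w R * (θ⁻¹ ^ 2 * (θ ^ 2) ^ Nat.dist q q₀)) ∧
        ∀ q, β r₀ q * R ^ v r₀ q ≤ w R * (θ ^ 2) ^ Nat.dist q q₀ := by
  obtain ⟨E, b, hE⟩ := ht
  obtain ⟨s, hs⟩ := exists_sparse_tropical (b := b) hE hw.continuous_logTransform
    hw.monotone_logTransform hr.exists_lt_logTransform (A := -Real.log θ)
    (by linarith [Real.log_neg hθ0 hθ1])
  -- Decay costs two indices per factor `θ = exp (-A)`, so a step of 4 within one class gains `θ ^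
  -- 2`.
  refine ⟨fun r q => s (4 * q + r), fun r q => Real.exp (b (s (4 * q + r))),
    fun r q => Real.exp_pos _, fun R hR => ?_⟩
  have hR0 : 0 < R := by linarith
  have hwR : 0 < w R := hw.pos R hR0.le
  obtain ⟨k, hk, hkm⟩ := hs (Real.log R) (Real.log_nonneg hR)
  have hΨ : logTransform w (Real.log R) = Real.log (w R) := by rw [logTransform, Real.exp_log hR0]
  rw [hΨ] at hk
  have hkm' : ∀ m i, (k + 2 * m ≤ i ∨ i + 2 * m ≤ k) →
      Real.exp (b (s i)) * R ^ s i ≤ w R * θ ^ m := fun m i h => by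
    rw [← exp_tropicalLine_log b _ hR0]
    refine (Real.exp_le_exp.2 (hkm m i h)).trans_eq ?_
    rw [hΨ, mul_neg, sub_neg_eq_add, Real.exp_add, Real.exp_log hwR, Real.exp_nat_mul,
      Real.exp_log hθ0]
  refine ⟨k / 4, ⟨k % 4, Nat.mod_lt _ (by norm_num)⟩, ?_, fun r q => ?_, fun q => ?_⟩
  · dsimp only
    rw [Nat.div_add_mod, ← exp_tropicalLine_log b _ hR0]
    refine le_trans (le_of_eq ?_) (Real.exp_le_exp.2 hk)
    rw [sub_neg_eq_add, Real.exp_add, Real.exp_log hwR, Real.exp_log hθ0, mul_comm]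
  -- In a general class the index offset can cost one step of `q`; truncated subtraction covers
  -- distance 0, and `θ⁻¹ ^ 2` pays for the loss.
  · refine (hkm' (2 * (Nat.dist q (k / 4) - 1)) (4 * q + r) ?_).trans ?_
    · have := r.2
      unfold Nat.dist; omega
    · gcongr
      rw [inv_pow, ← pow_mul, le_inv_mul_iff₀ (by positivity), ← pow_add]
      exact pow_le_pow_of_le_one hθ0.le hθ1.le (by omega)
  · rw [← pow_mul]
    refine hkm' (2 * Nat.dist q (k / 4)) (4 * q + k % 4) ?_
    unfold Nat.dist; omega

/-- For each `d` there is a number of entire functions on `ℂᵈ` sufficient to match every rapid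
log-tropical radial weight outside the unit ball. -/
theorem exists_entire_family {d : ℕ} (hd : 1 ≤ d) :
    ∃ M : ℕ, ∀ w : ℝ → ℝ, IsWeightFunction w → IsRapid w → IsLogTropical w →
      ∃ F : Fin 4 × (Fin d × (Fin d → Fin M)) → EuclideanSpace ℂ (Fin d) → ℂ,
        (∀ a, Differentiable ℂ (F a)) ∧ (∃ B, 0 < B ∧ ∀ a z, ‖F a z‖ ≤ B * w (max 1 ‖z‖)) ∧
        ∃ c, 0 < c ∧ ∀ z, 1 ≤ ‖z‖ → ∃ a, c * w ‖z‖ ≤ ‖F a z‖ := by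
  obtain ⟨M, K, δ, hK, hδ, W, hWd, hWK, hWδ⟩ := exists_homogeneous_family hd
  refine ⟨M, fun w hw hr ht => ?_⟩
  -- The main term is at least `δ θ w` and the tail at most `4 K θ² w`; this choice makes the tail
  -- at most half the main term.
  set θ := min (1 / 2) (δ / (8 * K)) with hθ
  have hθ0 : 0 < θ := lt_min (by norm_num) (by positivity)
  have hθ1 : θ ≤ 1 / 2 := min_le_left _ _
  have hθ2 : 8 * K * θ ≤ δ := by
    rw [mul_comm, ← le_div_iff₀ (by positivity)]; exact min_le_right _ _
  have hθs0 : 0 ≤ θ ^ 2 := by positivity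
  have hθs : θ ^ 2 ≤ 1 / 2 := by nlinarith
  obtain ⟨v, β, hβ, hvβ⟩ := exists_sparse_power_series hw hr ht hθ0 (by linarith)
  have hsum := fun q₀ => summable_pow_natDist hθs0 (by linarith) q₀
  have htsum := fun q₀ => tsum_pow_natDist_le hθs0 hθs q₀
  have hterm : ∀ r q a z R, ‖z‖ ≤ R → ‖(β r q : ℂ) * W (v r q) a z‖ ≤ K * (β r q * R ^ v r q) := by
    intro r q a z R hz
    rw [norm_mul, Complex.norm_real, Real.norm_of_nonneg (hβ r q).le]
    have h1 : ‖W (v r q) a z‖ ≤ K * R ^ v r q :=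
      (hWK _ a z).trans (by gcongr)
    calc _ ≤ β r q * (K * R ^ v r q) := mul_le_mul_of_nonneg_left h1 (hβ r q).le
      _ = _ := by ring
  refine ⟨fun a z => ∑' q, (β a.1 q : ℂ) * W (v a.1 q) a.2 z, fun a => ?_,
    ⟨3 * K * θ⁻¹ ^ 2, by positivity, fun a z => ?_⟩, ⟨δ * θ / 2, by positivity, fun z hz => ?_⟩⟩
  · refine differentiable_tsum_of_norm_le (fun q => (hWd _ _).const_mul _) fun R => ?_
    obtain ⟨q₀, r₀, -, hR, -⟩ := hvβ (max 1 R) (le_max_left _ _)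
    exact ⟨fun q => K * (w (max 1 R) * (θ⁻¹ ^ 2 * (θ ^ 2) ^ Nat.dist q q₀)),
      (((hsum q₀).mul_left _).mul_left _).mul_left _, fun q z hz =>
      (hterm _ q _ z (max 1 R) (hz.trans (le_max_right _ _))).trans
        (mul_le_mul_of_nonneg_left (hR _ q) hK.le)⟩
  · obtain ⟨q₀, r₀, -, hR, -⟩ := hvβ (max 1 ‖z‖) (le_max_left _ _)
    have hwR : 0 < w (max 1 ‖z‖) := hw.pos _ (by positivity)
    refine (tsum_of_norm_bounded ((((hsum q₀).hasSum.mul_left _).mul_left _).mul_left K) fun q =>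
      (hterm _ q _ z _ (le_max_right _ _)).trans
        (mul_le_mul_of_nonneg_left (hR _ q) hK.le)).trans ?_
    calc _ ≤ K * (w (max 1 ‖z‖) * (θ⁻¹ ^ 2 * 3)) := by
          gcongr
          linarith [htsum q₀]
      _ = _ := by ring
  · obtain ⟨q₀, r₀, hlow, -, hR⟩ := hvβ ‖z‖ hz
    have hwR : 0 < w ‖z‖ := hw.pos _ (norm_nonneg z)
    obtain ⟨a, ha⟩ := hWδ (v r₀ q₀) z
    refine ⟨(r₀, a), ?_⟩
    have hbd : ∀ q, ‖(β r₀ q : ℂ) * W (v r₀ q) a z‖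
        ≤ K * (w ‖z‖ * (θ ^ 2) ^ Nat.dist q q₀) := fun q =>
      (hterm _ q _ z _ le_rfl).trans (mul_le_mul_of_nonneg_left (hR q) hK.le)
    have hg := ((hsum q₀).hasSum.mul_left (w ‖z‖)).mul_left K
    have hrest := tsum_of_norm_bounded
      (f := fun q => if q = q₀ then 0 else (β r₀ q : ℂ) * W (v r₀ q) a z)
      (hasSum_ite_sub_hasSum hg q₀) fun q => by
        split_ifs
        · simp
        · exact hbd q
    rw [Nat.dist_self, pow_zero] at hrest
    have hrest' : K * (w ‖z‖ * ∑' q, (θ ^ 2) ^ Nat.dist q q₀) - K * (w ‖z‖ * 1)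
        ≤ K * w ‖z‖ * (4 * θ ^ 2) := by
      have : K * w ‖z‖ * ∑' q, (θ ^ 2) ^ Nat.dist q q₀ ≤ K * w ‖z‖ * (1 + 4 * θ ^ 2) := by
        gcongr
        exact htsum q₀
      linarith
    have hmain : δ * θ * w ‖z‖ ≤ ‖(β r₀ q₀ : ℂ) * W (v r₀ q₀) a z‖ := by
      rw [norm_mul, Complex.norm_real, Real.norm_of_nonneg (hβ r₀ q₀).le]
      calc δ * θ * w ‖z‖ = δ * (θ * w ‖z‖) := by ring
        _ ≤ δ * (β r₀ q₀ * ‖z‖ ^ v r₀ q₀) := by gcongr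
        _ = β r₀ q₀ * (δ * ‖z‖ ^ v r₀ q₀) := by ring
        _ ≤ _ := mul_le_mul_of_nonneg_left ha (hβ _ _).le
    dsimp only
    rw [(Summable.of_norm_bounded hg.summable hbd).tsum_eq_add_tsum_ite q₀]
    have h1 := norm_sub_le_norm_add ((β r₀ q₀ : ℂ) * W (v r₀ q₀) a z)
      (∑' q, if q = q₀ then 0 else (β r₀ q : ℂ) * W (v r₀ q) a z)
    have h2 : K * w ‖z‖ * (4 * θ ^ 2) ≤ δ * θ / 2 * w ‖z‖ := by
      have : 8 * K * θ * (θ * w ‖z‖) ≤ δ * (θ * w ‖z‖) := by gcongr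
      linarith
    linarith

theorem IsRapid.exists_le_mul (hw : IsWeightFunction w) (hr : IsRapid w) :
    ∃ B, 0 < B ∧ ∀ t, 0 ≤ t → t ≤ B * w t := by
  obtain ⟨T, hT⟩ := eventually_atTop.1 ((hr 1).eventually_ge_atTop 1)
  have hw0 : 0 < w 0 := hw.pos 0 le_rfl
  refine ⟨1 + |T| / w 0, by positivity, fun t ht => ?_⟩
  have hwt : w 0 ≤ w t := hw.monotoneOn self_mem_Ici ht ht
  have hq : 0 ≤ |T| / w 0 := by positivity
  rcases ht.eq_or_lt with rfl | ht'
  · positivity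
  rcases le_total T t with h | h
  · have := hT t h
    rw [pow_one, inv_mul_eq_div, le_div_iff₀ ht'] at this
    nlinarith
  · have h1 : |T| / w 0 * w 0 = |T| := div_mul_cancel₀ _ hw0.ne'
    nlinarith [le_abs_self T]

end Weight

/-! ### Assembling the embedding -/

/-- A holomorphic map with a continuous linear left inverse is a proper holomorphic embedding. -/
theorem IsProperHolomorphicEmbedding.of_leftInverse {d n : ℕ}
    {f : EuclideanSpace ℂ (Fin d) → EuclideanSpace ℂ (Fin n)} (hf : Differentiable ℂ f)
    (L : EuclideanSpace ℂ (Fin n) →L[ℂ] EuclideanSpace ℂ (Fin d)) (hL : Function.LeftInverse L f) :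
    IsProperHolomorphicEmbedding f where
  holomorphic := hf
  proper := by
    refine isProperMap_of_comp_of_t2 hf.continuous L.continuous ?_
    rw [hL.comp_eq_id]
    exact isProperMap_id
  immersion z := by
    have h : HasFDerivAt (L ∘ f) (L ∘L fderiv ℂ f z) z :=
      L.hasFDerivAt.comp z (hf z).hasFDerivAt
    rw [hL.comp_eq_id] at h
    have h' := h.unique (hasFDerivAt_id z)
    exact Function.LeftInverse.injective (g := L) fun v => DFunLike.congr_fun h' v
  injective := hL.injective

theorem norm_euclidean_le_card_mul {n : ℕ} {x : EuclideanSpace ℂ (Fin n)} {B : ℝ}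
    (hB : 0 ≤ B) (h : ∀ i, ‖x i‖ ≤ B) : ‖x‖ ≤ n * B := by
  refine abs_le_of_sq_le_sq' ?_ (by positivity) |>.2
  rw [EuclideanSpace.norm_sq_eq]
  calc ∑ i, ‖x i‖ ^ 2 ≤ ∑ _i : Fin n, B ^ 2 := by gcongr with i; exact h i
    _ = n * B ^ 2 := by simp
    _ ≤ (n : ℝ) ^ 2 * B ^ 2 := by
      gcongr
      exact_mod_cast Nat.le_self_pow two_ne_zero n
    _ = _ := by ring

theorem corollary6p5 (d : ℕ) (hd : 1 ≤ d) :
    ∃ n : ℕ, ∀ w : ℝ → ℝ, IsWeightFunction w → IsRapid w → IsLogTropical w →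
      ∃ f : EuclideanSpace ℂ (Fin d) → EuclideanSpace ℂ (Fin n),
        IsProperHolomorphicEmbedding f ∧
          FunEquivalent (fun z => ‖f z‖) (radialWeight d w) := by
  obtain ⟨M, hM⟩ := exists_entire_family hd
  let e := (Fintype.equivFin (Fin d ⊕ Unit ⊕ (Fin 4 × (Fin d × (Fin d → Fin M))))).symm
  set n := Fintype.card (Fin d ⊕ Unit ⊕ (Fin 4 × (Fin d × (Fin d → Fin M))))
  refine ⟨n, fun w hw hr ht => ?_⟩
  obtain ⟨F, hFd, ⟨B, hB, hFB⟩, ⟨c, hc, hFc⟩⟩ := hM w hw hr ht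
  obtain ⟨D, hD, hDw⟩ := hr.exists_le_mul hw
  let G : Fin d ⊕ Unit ⊕ (Fin 4 × (Fin d × (Fin d → Fin M))) → EuclideanSpace ℂ (Fin d) → ℂ :=
    Sum.elim (fun i z => z i) (Sum.elim (fun _ _ => 1) F)
  let f : EuclideanSpace ℂ (Fin d) → EuclideanSpace ℂ (Fin n) :=
    fun z => WithLp.toLp 2 fun i => G (e i) z
  have hG : ∀ k, Differentiable ℂ (G k) := by
    rintro (i | _ | a)
    · exact differentiable_euclidean.1 differentiable_id i
    · exact differentiable_const _
    · exact hFd a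
  have hfG : ∀ k z, ‖G k z‖ ≤ ‖f z‖ := fun k z => by
    simpa [f] using PiLp.norm_apply_le (f z) (e.symm k)
  let L : EuclideanSpace ℂ (Fin n) →ₗ[ℂ] EuclideanSpace ℂ (Fin d) :=
    { toFun := fun y => WithLp.toLp 2 fun i => y (e.symm (Sum.inl i))
      map_add' := fun _ _ => rfl
      map_smul' := fun _ _ => rfl }
  refine ⟨f, .of_leftInverse (differentiable_euclidean.2 fun i => hG (e i))
    (LinearMap.toContinuousLinearMap L) fun z => ?_, ?_⟩
  · ext i
    change G (e (e.symm (Sum.inl i))) z = z i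
    rw [e.apply_symm_apply]
    rfl
  have hw0 : 0 < w 0 := hw.pos 0 le_rfl
  have hw1 : 0 < w 1 := hw.pos 1 zero_le_one
  have hwz : ∀ z : EuclideanSpace ℂ (Fin d), w 0 ≤ w ‖z‖ := fun z =>
    hw.monotoneOn self_mem_Ici (norm_nonneg z) (norm_nonneg z)
  -- `D` serves the coordinates, `1 / w 0` the constant 1, and `B` and `B * (w 1 / w 0)` the
  -- functions `F` outside and inside the unit ball.
  set U : ℝ := D + 1 / w 0 + B + B * (w 1 / w 0) with hU
  have hU0 : 0 < U := by positivity
  have hGU : ∀ k z, ‖G k z‖ ≤ U * w ‖z‖ := by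
    intro k z
    have hz := hwz z
    have hz0 : 0 < w ‖z‖ := hw0.trans_le hz
    have h1 : ‖z‖ ≤ D * w ‖z‖ := hDw _ (norm_nonneg z)
    have h2 : 1 ≤ 1 / w 0 * w ‖z‖ := by rw [one_div_mul_eq_div, le_div_iff₀ hw0]; linarith
    have h3 : 0 ≤ B * w ‖z‖ := by positivity
    have h4 : 0 ≤ B * (w 1 / w 0) * w ‖z‖ := by positivity
    have h5 : B * w (max 1 ‖z‖) ≤ B * w ‖z‖ + B * (w 1 / w 0) * w ‖z‖ := by
      rcases max_choice 1 ‖z‖ with h | h <;> rw [h]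
      · have : w 1 ≤ w 1 / w 0 * w ‖z‖ := by
          rw [div_mul_eq_mul_div, le_div_iff₀ hw0]; gcongr
        nlinarith
      · linarith
    rw [hU, add_mul, add_mul, add_mul]
    obtain i | _ | a := k
    · have : ‖G (Sum.inl i) z‖ ≤ ‖z‖ := PiLp.norm_apply_le z i
      linarith
    · have : ‖G (Sum.inr (Sum.inl ())) z‖ = 1 := by simp [G]
      have h6 : 0 ≤ D * w ‖z‖ := by positivity
      linarith
    · have : ‖G (Sum.inr (Sum.inr a)) z‖ ≤ B * w (max 1 ‖z‖) := hFB a z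
      linarith [norm_nonneg z]
  -- `c⁻¹` is for `1 ≤ ‖z‖`, and `w 1` is for the unit ball, where the constant component gives `1 ≤
  -- ‖f z‖`. The `+ 1` keeps the first constant visibly positive.
  refine ⟨((n + 1) * U)⁻¹, w 1 + c⁻¹, by positivity, by positivity, fun z => ⟨?_, ?_⟩⟩
  · have hz0 : 0 < w ‖z‖ := hw0.trans_le (hwz z)
    rw [inv_mul_le_iff₀ (by positivity)]
    have := norm_euclidean_le_card_mul (x := f z) (by positivity) fun i => hGU (e i) z
    have h2 : 0 ≤ U * w ‖z‖ := by positivity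
    unfold radialWeight
    linarith
  · unfold radialWeight
    rw [add_mul]
    have hci : 0 ≤ c⁻¹ * ‖f z‖ := by positivity
    have hwi : 0 ≤ w 1 * ‖f z‖ := by positivity
    rcases le_total 1 ‖z‖ with h | h
    · obtain ⟨a, ha⟩ := hFc z h
      have h1 : c * w ‖z‖ ≤ ‖f z‖ := ha.trans (hfG (Sum.inr (Sum.inr a)) z)
      have h2 : w ‖z‖ ≤ c⁻¹ * ‖f z‖ := by rwa [le_inv_mul_iff₀ hc]
      linarith
    · have h1 : (1 : ℝ) ≤ ‖f z‖ := by simpa [G] using hfG (Sum.inr (Sum.inl ())) z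
      have h2 : w ‖z‖ ≤ w 1 := hw.monotoneOn (norm_nonneg z) (zero_le_one (α := ℝ)) h
      nlinarith
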